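/- Let $\rho$ be a (mixed) state of two qubits, i.e. a positive semidefinite $4\times4$ complex matrix of trace $1$ on $\mathbb C^2\otimes\mathbb C^2$, and let $\rho^\Gamma$ be its partial transpose (with respect to the second qubit). A vector $\psi\in\mathbb C^2\otimes\mathbb C^2$ is called maximally entangled if its one-qubit reduced state is $\tfrac12 I$ (so $\psi$ is a unit vector). Define - the fidelity (maximal singlet fraction) $F=\max\{\langle\psi|\rho|\psi\rangle : \psi \text{ maximally entangled}\}$; - the negativity $N=\max\bigl(0,-2\lambda_{\min}(\rho^\Gamma)\bigr)$, where $\lambda_{\min}$ is the smallest eigenvalue; - the concurrence $C=\max(0,l_1-l_2-l_3-l_4)$, where $l_1\ge l_2\ge l_3\ge l_4$ are the square roots of the eigenvalues (with multiplicity) of $\rho\,(\sigma_y\otimes\sigma_y)\rho^*(\sigma_y\otimes\sigma_y)$, with $\rho^*$ the entrywise complex conjugate of $\rho$ and $\sigma_y=\begin{pmatrix}0&-i\\ i&0\end{pmatrix}$. Then $$F\le\frac{1+N}{2}\le\frac{1+C}{2}.$$ Moreover, if $F=\frac{1+N}{2}$ then $N=C$. If $\rho^\Gamma$ has a negative eigenvalue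 (equivalently $N>0$), then the converse holds as well, so that $F=\frac{1+N}{2}$ if and only if $N=C$; furthermore $\rho^\Gamma$ then has exactly one negative eigenvalue, its eigenspace is one-dimensional, and $N=C$ if and only if the normalized eigenvector belonging to this negative eigenvalue is maximally entangled. -/

import Mathlib

open Matrix
open scoped ComplexOrder

noncomputable section

namespace TwoQubit

/-- Index set of the product basis `|i j⟩` of `ℂ² ⊗ ℂ²`. -/
abbrev Idx : Type := Fin 2 × Fin 2

/-- A (mixed) two-qubit state: a positive semidefinite `4 × 4` matrix of trace one. -/
structure IsState (ρ : Matrix Idx Idx ℂ) : Prop where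
  posSemidef : ρ.PosSemidef
  trace_eq_one : ρ.trace = 1

/-- Partial transpose with respect to the second qubit:
`⟨i j| ρ^Γ |k l⟩ = ⟨i l| ρ |k j⟩`. -/
def partialTranspose (ρ : Matrix Idx Idx ℂ) : Matrix Idx Idx ℂ :=
  Matrix.of fun a b => ρ (a.1, b.2) (b.1, a.2)

/-- The state of the first qubit when the pair is in the pure state `ψ`
(partial trace of `|ψ⟩⟨ψ|` over the second qubit). -/
def reducedState (ψ : Idx → ℂ) : Matrix (Fin 2) (Fin 2) ℂ :=
  Matrix.of fun i k => ∑ j, ψ (i, j) * star (ψ (k, j))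

/-- `ψ` is a maximally entangled vector: its one-qubit reduced state is maximally mixed.
Taking traces, such a `ψ` is automatically a unit vector. -/
def IsMaxEntangled (ψ : Idx → ℂ) : Prop :=
  reducedState ψ = (1 / 2 : ℂ) • (1 : Matrix (Fin 2) (Fin 2) ℂ)

/-- The overlap `⟨ψ|ρ|ψ⟩`. -/
def overlap (ρ : Matrix Idx Idx ℂ) (ψ : Idx → ℂ) : ℝ :=
  (star ψ ⬝ᵥ (ρ *ᵥ ψ)).re

/-- Fidelity (maximal singlet fraction): the maximal overlap of `ρ` with a maximally
entangled vector. -/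
def fidelity (ρ : Matrix Idx Idx ℂ) : ℝ :=
  sSup (overlap ρ '' {ψ | IsMaxEntangled ψ})

/-- The minimal (real) eigenvalue of a matrix; used for Hermitian matrices. -/
def minEigenvalue (A : Matrix Idx Idx ℂ) : ℝ :=
  sInf {x : ℝ | ∃ v : Idx → ℂ, v ≠ 0 ∧ A *ᵥ v = (x : ℂ) • v}

/-- Negativity: `N(ρ) = max (0, -2 λ_min(ρ^Γ))`. -/
def negativity (ρ : Matrix Idx Idx ℂ) : ℝ :=
  max 0 (-2 * minEigenvalue (partialTranspose ρ))

/-- The Pauli matrix `σ_y`. -/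
def pauliY : Matrix (Fin 2) (Fin 2) ℂ := !![0, -Complex.I; Complex.I, 0]

/-- The spin-flipped matrix `(σ_y ⊗ σ_y) ρ* (σ_y ⊗ σ_y)`, where `ρ*` is the entrywise complex
conjugate of `ρ` in the product basis. -/
def spinFlip (ρ : Matrix Idx Idx ℂ) : Matrix Idx Idx ℂ :=
  kroneckerMap (· * ·) pauliY pauliY * ρ.map star * kroneckerMap (· * ·) pauliY pauliY

/-- The square roots of the four eigenvalues of `ρ (spinFlip ρ)` (which are real and
nonnegative when `ρ` is a state), with multiplicity, in decreasing order. -/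
def woottersList (ρ : Matrix Idx Idx ℂ) : List ℝ :=
  ((ρ * spinFlip ρ).charpoly.roots.map fun z => Real.sqrt z.re).sort (· ≥ ·)

/-- Wootters' concurrence `C(ρ) = max (0, l₁ - l₂ - l₃ - l₄)`, where `l₁ ≥ l₂ ≥ l₃ ≥ l₄` are
the square roots of the eigenvalues of `ρ (spinFlip ρ)`. -/
def concurrence (ρ : Matrix Idx Idx ℂ) : ℝ :=
  max 0 ((woottersList ρ).getD 0 0 - (woottersList ρ).getD 1 0
    - (woottersList ρ).getD 2 0 - (woottersList ρ).getD 3 0)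

/-- The maximally entangled vectors form a compact set. -/
theorem isCompact_maxEntangled : IsCompact {ψ : Idx → ℂ | IsMaxEntangled ψ} := by
  refine Metric.isCompact_of_isClosed_isBounded ?_ ?_
  · refine isClosed_eq ?_ continuous_const
    refine continuous_pi fun i => continuous_pi fun k => ?_
    simp only [reducedState, Matrix.of_apply]
    fun_prop
  · refine (Metric.isBounded_closedBall (x := (0 : Idx → ℂ)) (r := 1)).subset ?_
    intro ψ hψ
    rw [mem_closedBall_zero_iff, pi_norm_le_iff_of_nonneg zero_le_one]
    rintro ⟨i, j⟩
    have h := congrFun (congrFun hψ i) i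
    simp only [reducedState, Matrix.of_apply, Matrix.smul_apply, Matrix.one_apply_eq,
      Complex.star_def, Complex.mul_conj, smul_eq_mul, mul_one] at h
    have h' : ∑ j, Complex.normSq (ψ (i, j)) = 1 / 2 := by
      have := congrArg Complex.re h
      simpa using this
    have h2 : Complex.normSq (ψ (i, j)) ≤ 1 / 2 := by
      rw [← h']
      exact Finset.single_le_sum (f := fun j => Complex.normSq (ψ (i, j)))
        (fun _ _ => Complex.normSq_nonneg _) (Finset.mem_univ j)
    rw [Complex.normSq_eq_norm_sq] at h2
    nlinarith [norm_nonneg (ψ (i, j))]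

/-- Maximally entangled vectors exist. -/
theorem exists_maxEntangled : {ψ : Idx → ℂ | IsMaxEntangled ψ}.Nonempty := by
  refine ⟨fun a => if a.1 = a.2 then ((Real.sqrt (1 / 2) : ℝ) : ℂ) else 0, ?_⟩
  have hs : ((Real.sqrt (1 / 2) : ℝ) : ℂ) * ((Real.sqrt (1 / 2) : ℝ) : ℂ) = 1 / 2 := by
    rw [← Complex.ofReal_mul, Real.mul_self_sqrt (by norm_num)]; norm_num
  ext i k
  fin_cases i <;> fin_cases k <;>
    simp [reducedState, -one_div, -Real.sqrt_inv] <;> simpa using hs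

/-- The supremum in the definition of the fidelity is a maximum. -/
theorem isGreatest_fidelity (ρ : Matrix Idx Idx ℂ) :
    IsGreatest (overlap ρ '' {ψ | IsMaxEntangled ψ}) (fidelity ρ) := by
  refine (isCompact_maxEntangled.image ?_).isGreatest_sSup (exists_maxEntangled.image _)
  unfold overlap dotProduct Matrix.mulVec dotProduct
  simp only [Pi.star_apply]
  fun_prop

/-- For a Hermitian matrix the infimum in the definition of `minEigenvalue` is a minimum. -/
theorem isLeast_minEigenvalue {A : Matrix Idx Idx ℂ} (hA : A.IsHermitian) :
    IsLeast {x : ℝ | ∃ v : Idx → ℂ, v ≠ 0 ∧ A *ᵥ v = (x : ℂ) • v} (minEigenvalue A) := by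
  have hS : {x : ℝ | ∃ v : Idx → ℂ, v ≠ 0 ∧ A *ᵥ v = (x : ℂ) • v}
      = Set.range hA.eigenvalues := by
    ext x
    rw [← hA.spectrum_real_eq_range_eigenvalues, Set.mem_ofPred_eq,
      ← spectrum.algebraMap_mem_iff ℂ, ← Matrix.spectrum_toLin',
      ← Module.End.hasEigenvalue_iff_mem_spectrum]
    constructor
    · rintro ⟨v, hv, h⟩
      exact Module.End.hasEigenvalue_of_hasEigenvector (x := v)
        ⟨Module.End.mem_eigenspace_iff.2 (by simpa using h), hv⟩
    · intro h
      obtain ⟨v, hv⟩ := h.exists_hasEigenvector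
      exact ⟨v, hv.2, by simpa using hv.apply_eq_smul⟩
  unfold minEigenvalue
  rw [hS]
  exact ⟨(Set.range_nonempty _).csInf_mem (Set.finite_range _),
    fun x hx => csInf_le (Set.finite_range _).bddBelow hx⟩

end TwoQubit

end

/-!
Everything is governed by the quadratic form `q(v) = ⟨v|ρ^Γ|v⟩`.

*Fidelity.* If `v` is maximally entangled and `u` is `v` with the second qubit rotated by `i σ_y`,
then `(v v†)^Γ = 1 / 2 - u u†`, so `⟨u|ρ|u⟩ = 1 / 2 - q(v)`
(`IsMaxEntangled.overlap_flipSecond`). Hence `F = 1 / 2 - min q` over maximally entangled vectors.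
As `q ≥ -N / 2` on unit vectors, `F ≤ (1 + N) / 2`, with equality exactly when `-N / 2` is an
eigenvalue of `ρ^Γ` with a maximally entangled eigenvector.

*Negativity against concurrence.* For every `v`, `q(v) ≥ -C |det v|`, where `v` is read as a
`2 × 2` matrix (`overlap_partialTranspose_ge`). For a pure state this is an elementary inequality;
in general it follows from Wootters' decomposition of `ρ` into vectors with `∑ 2 |det| ≤ C`
(`exists_wootters_decomposition`), which rests on the Takagi factorization (`exists_takagi`).
A unit vector has `2 |det v| ≤ 1`, with equality only if it is maximally entangled. So `N ≤ C`, and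
if `N = C > 0` then the eigenvector of `-N / 2` is maximally entangled. Moreover `q ≥ 0` on product
vectors, and every plane contains one, so at most one eigenvalue of `ρ^Γ` is negative, and it is
simple.

*Equality.* Suppose `ρ^Γ v = x v` with `v` maximally entangled and `x ≤ 0`. After a rotation of the
second qubit, `v` is `(|00⟩ + |11⟩) / √2`, and the eigenvalue equation says that the spin flip of `ρ`
is `W ρ W` with `W` the swap (`spinFlip_eq_swap_conj`). Then `ρ` times its spin flip is `(ρ W)²`, and
`ρ W` has real eigenvalues, at most one of them negative, with sum `tr (ρ W) = 2 x ≤ 0`; hence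
`C = -2 x` (`IsMaxEntangled.concurrence_eq`).
-/

/-! ### Takagi factorization -/

/-- A conjugate-linear map `T` with `⟪T x, y⟫ = ⟪T y, x⟫` on a nonzero space has a unit vector `u`
with `T u = s u`, `s ≥ 0`. Its square is linear and positive, so it has an eigenvector `x`, with
eigenvalue `s ^ 2`; then `u` is a multiple of `T x + s x`, or of `i x` when that vector is zero. -/
theorem exists_unit_antilinear_eigenvector {E : Type*} [NormedAddCommGroup E]
    [InnerProductSpace ℂ E] [FiniteDimensional ℂ E] [Nontrivial E] (T : E →ₗ⋆[ℂ] E)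
    (hT : ∀ x y, inner ℂ (T x) y = inner ℂ (T y) x) :
    ∃ (u : E) (s : ℝ), ‖u‖ = 1 ∧ 0 ≤ s ∧ T u = (s : ℂ) • u := by
  obtain ⟨c, hc⟩ := Module.End.exists_eigenvalue (K := ℂ) (T.comp T : E →ₗ[ℂ] E)
  obtain ⟨x, hx⟩ := hc.exists_hasEigenvector
  have hx0 : x ≠ 0 := hx.2
  have hxx : T (T x) = c • x := hx.apply_eq_smul
  have hnx : ‖x‖ ≠ 0 := norm_ne_zero_iff.2 hx0
  set s : ℝ := ‖T x‖ / ‖x‖ with hs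
  have hs0 : 0 ≤ s := by positivity
  have hcs : c = (s : ℂ) ^ 2 := by
    have h1 : inner ℂ (T (T x)) x = inner ℂ (T x) (T x) := hT _ _
    rw [hxx, inner_smul_left, inner_self_eq_norm_sq_to_K, inner_self_eq_norm_sq_to_K] at h1
    have h2 : (starRingEnd ℂ) c = (s : ℂ) ^ 2 := by
      have hnx' : (‖x‖ : ℂ) ≠ 0 := by exact_mod_cast hnx
      rw [hs]; push_cast
      field_simp
      simpa using h1
    rw [← Complex.conj_conj c, h2]; simp
  suffices h : ∃ u : E, u ≠ 0 ∧ T u = (s : ℂ) • u by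
    obtain ⟨u, hu, hTu⟩ := h
    have hnu : (‖u‖ : ℂ) ≠ 0 := by exact_mod_cast norm_ne_zero_iff.2 hu
    refine ⟨((‖u‖⁻¹ : ℝ) : ℂ) • u, s, ?_, hs0, ?_⟩
    · rw [norm_smul]
      simp [norm_ne_zero_iff.2 hu]
    · rw [LinearMap.map_smulₛₗ, hTu, smul_comm, Complex.conj_ofReal]
  by_cases h : T x + (s : ℂ) • x = 0
  · refine ⟨Complex.I • x, smul_ne_zero Complex.I_ne_zero hx0, ?_⟩
    rw [LinearMap.map_smulₛₗ, eq_neg_of_add_eq_zero_left h, Complex.conj_I, smul_neg, neg_smul,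
      neg_neg, smul_comm]
  · refine ⟨_, h, ?_⟩
    rw [map_add, LinearMap.map_smulₛₗ, hxx, hcs, Complex.conj_ofReal, smul_add, smul_smul, ← sq,
      add_comm]

/-- Basis form of the Takagi factorization: a symmetric conjugate-linear map is diagonal, with
nonnegative entries, in some orthonormal basis. -/
theorem exists_orthonormalBasis_antilinear (n : ℕ) : ∀ {E : Type*} [NormedAddCommGroup E]
    [InnerProductSpace ℂ E] [FiniteDimensional ℂ E] (_ : Module.finrank ℂ E = n)
    (T : E →ₗ⋆[ℂ] E) (_ : ∀ x y, inner ℂ (T x) y = inner ℂ (T y) x),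
    ∃ (b : OrthonormalBasis (Fin n) ℂ E) (l : Fin n → ℝ),
      ∀ i, 0 ≤ l i ∧ T (b i) = (l i : ℂ) • b i := by
  induction n with
  | zero =>
    intro E _ _ _ hE T _
    exact ⟨(stdOrthonormalBasis ℂ E).reindex (finCongr hE), 0, fun i => i.elim0⟩
  | succ n ih =>
    intro E _ _ _ hE T hT
    have : Nontrivial E := Module.nontrivial_of_finrank_pos (R := ℂ) (by omega)
    obtain ⟨u, s, hu, hs, hTu⟩ := exists_unit_antilinear_eigenvector T hT
    have hu0 : u ≠ 0 := by rintro rfl; simp at hu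
    have : Fact (Module.finrank ℂ E = n + 1) := ⟨hE⟩
    have hmap : ∀ x ∈ (ℂ ∙ u)ᗮ, T x ∈ (ℂ ∙ u)ᗮ := by
      intro x hx
      rw [Submodule.mem_orthogonal_singleton_iff_inner_left] at *
      rw [hT, hTu, inner_smul_left, ← inner_conj_symm, hx]
      simp
    obtain ⟨b, l, hbl⟩ := ih (Submodule.finrank_orthogonal_span_singleton (n := n) hu0)
      (T.restrict hmap) (fun x y => hT x y)
    have hub : ∀ i, inner ℂ u (b i : E) = 0 := fun i =>
      Submodule.mem_orthogonal_singleton_iff_inner_right.1 (b i).2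
    have hbb : ∀ i j, inner ℂ (b i : E) (b j : E) = if i = j then (1 : ℂ) else 0 := fun i j =>
      orthonormal_iff_ite.1 b.orthonormal i j
    have hon : Orthonormal ℂ (Fin.cons u (fun i => (b i : E)) : Fin (n + 1) → E) := by
      rw [orthonormal_iff_ite]
      intro i j
      refine Fin.cases ?_ (fun i => ?_) i <;> refine Fin.cases ?_ (fun j => ?_) j
      · simp [hu]
      · simp [hub, (Fin.succ_ne_zero j).symm]
      · rw [← inner_conj_symm]
        simp [hub, Fin.succ_ne_zero i]
      · simp [hbb]
    obtain ⟨b', hb'⟩ := Orthonormal.exists_orthonormalBasis_extension_of_card_eq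
      (v := (Fin.cons u (fun i => (b i : E)) : Fin (n + 1) → E)) (s := Set.univ)
      (by simpa using hE) (hon.comp _ Subtype.val_injective)
    refine ⟨b', Fin.cons s l, fun i => ?_⟩
    rw [hb' i (Set.mem_univ _)]
    refine Fin.cases ?_ (fun i => ?_) i
    · exact ⟨hs, hTu⟩
    · exact ⟨(hbl i).1, congrArg Subtype.val (hbl i).2⟩

/-- **Takagi factorization** of a complex symmetric matrix, with the diagonal in decreasing
order. -/
theorem exists_takagi {ι : Type*} [Fintype ι] [DecidableEq ι] {n : ℕ} (hn : Fintype.card ι = n)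
    (τ : Matrix ι ι ℂ) (hτ : τᵀ = τ) :
    ∃ (U : Matrix ι (Fin n) ℂ) (l : Fin n → ℝ), U * Uᴴ = 1 ∧ (∀ i, 0 ≤ l i) ∧
      Antitone l ∧ Uᵀ * τ * U = diagonal (fun i => (l i : ℂ)) := by
  let T : EuclideanSpace ℂ ι →ₗ⋆[ℂ] EuclideanSpace ℂ ι :=
    { toFun := fun z => WithLp.toLp 2 (star (τ *ᵥ z.ofLp))
      map_add' := fun x y => by ext i; simp [mulVec_add]
      map_smul' := fun c x => by ext i; simp [mulVec_smul] }
  have hT : ∀ x y, inner ℂ (T x) y = inner ℂ (T y) x := by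
    intro x y
    simp only [T, LinearMap.coe_mk, AddHom.coe_mk, EuclideanSpace.inner_eq_star_dotProduct,
      star_star]
    rw [dotProduct_mulVec, ← mulVec_transpose, hτ, dotProduct_comm]
  obtain ⟨b, l, hbl⟩ := exists_orthonormalBasis_antilinear n (by simpa using hn) T hT
  let e : Equiv.Perm (Fin n) := Tuple.sort (fun i => -l i)
  have hmono : Antitone (l ∘ e) := fun i j hij => by
    have := Tuple.monotone_sort (fun i => -l i) hij
    simpa using this
  have hb : ∀ i, τ *ᵥ (b i).ofLp = (l i : ℂ) • star (b i).ofLp := fun i => by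
    have h := congrArg (fun z : EuclideanSpace ℂ ι => star z.ofLp) (hbl i).2
    simpa [T] using h
  have hort : ∀ i j, (b i).ofLp ⬝ᵥ star (b j).ofLp = if i = j then (1 : ℂ) else 0 := fun i j => by
    have h := orthonormal_iff_ite.1 b.orthonormal j i
    rw [EuclideanSpace.inner_eq_star_dotProduct] at h
    simp only [h, eq_comm]
  let U : Matrix ι (Fin n) ℂ := of fun a m => (b (e m)).ofLp a
  refine ⟨U, l ∘ e, ?_, fun i => (hbl _).1, hmono, ?_⟩
  · have h : Uᴴ * U = 1 := by
      ext i j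
      have h := hort (e j) (e i)
      rw [dotProduct_comm] at h
      simp only [dotProduct, Pi.star_apply] at h
      simp only [mul_apply, conjTranspose_apply, U, of_apply, h, one_apply, e.injective.eq_iff,
        eq_comm]
    exact (mul_eq_one_comm_of_card_eq _ _ _ (by simpa using hn.symm)).1 h
  · ext i j
    have h1 : (Uᵀ * τ * U) i j = (b (e i)).ofLp ⬝ᵥ (τ *ᵥ (b (e j)).ofLp) := by
      rw [dotProduct_mulVec]; rfl
    rw [h1, hb, dotProduct_smul, hort, diagonal_apply]
    by_cases h : i = j <;> simp [h]

noncomputable section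

namespace TwoQubit

/-! ### The concurrence and optimal decompositions -/

/-- The determinant of a two-qubit vector viewed as a `2 × 2` matrix of coefficients. It vanishes
exactly on product vectors. -/
def qubitDet (v : Idx → ℂ) : ℂ := v (0, 0) * v (1, 1) - v (0, 1) * v (1, 0)

/-- The matrix `σ_y ⊗ σ_y` of the spin flip. -/
def pauliYY : Matrix Idx Idx ℂ := kroneckerMap (· * ·) pauliY pauliY

theorem spinFlip_eq (ρ : Matrix Idx Idx ℂ) : spinFlip ρ = pauliYY * ρ.map star * pauliYY := rfl

theorem pauliYY_map_star : pauliYY.map star = pauliYY := by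
  ext ⟨i, j⟩ ⟨k, l⟩
  fin_cases i <;> fin_cases j <;> fin_cases k <;> fin_cases l <;> simp [pauliYY, pauliY]

theorem pauliYY_transpose : pauliYYᵀ = pauliYY := by
  ext ⟨i, j⟩ ⟨k, l⟩
  fin_cases i <;> fin_cases j <;> fin_cases k <;> fin_cases l <;> simp [pauliYY, pauliY]

theorem dotProduct_pauliYY_mulVec (w : Idx → ℂ) : w ⬝ᵥ (pauliYY *ᵥ w) = -2 * qubitDet w := by
  simp [dotProduct, mulVec, Fintype.sum_prod_type, pauliYY, pauliY, qubitDet]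
  ring

/-- The concurrence read off from the roots of the characteristic polynomial. -/
theorem concurrence_eq_of_roots {ρ : Matrix Idx Idx ℂ} {a : Fin 4 → ℝ} (ha : ∀ i, 0 ≤ a i)
    (hanti : Antitone a) (h : (ρ * spinFlip ρ).charpoly.roots =
      Finset.univ.val.map (fun i => (((a i) ^ 2 : ℝ) : ℂ))) :
    concurrence ρ = max 0 (a 0 - a 1 - a 2 - a 3) := by
  have hl : woottersList ρ = List.ofFn a := by
    have h2 : (fun z : ℂ => Real.sqrt z.re) ∘ (fun i => (((a i) ^ 2 : ℝ) : ℂ)) = a := by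
      funext i
      simp only [Function.comp, Complex.ofReal_re, Real.sqrt_sq (ha i)]
    rw [woottersList, h, Multiset.map_map, h2, Fin.univ_val_map, Multiset.coe_sort]
    exact List.mergeSort_eq_self _ hanti.sortedGE_ofFn.pairwise
  rw [concurrence, hl]
  simp [List.ofFn_succ]

/-- If the columns of `X` decompose `ρ` and diagonalize the form of the spin flip, the concurrence
is given by the diagonal entries, since `ρ * spinFlip ρ` has the same characteristic polynomial as
the square of the diagonal matrix. -/
theorem concurrence_eq_of_diagonal {ρ : Matrix Idx Idx ℂ} {X : Matrix Idx (Fin 4) ℂ}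
    {l : Fin 4 → ℝ} (hX : ρ = X * Xᴴ) (hl : ∀ i, 0 ≤ l i) (hanti : Antitone l)
    (hd : Xᵀ * pauliYY * X = diagonal (fun i => (l i : ℂ))) :
    concurrence ρ = max 0 (l 0 - l 1 - l 2 - l 3) := by
  refine concurrence_eq_of_roots hl hanti ?_
  have hd' : Xᴴ * pauliYY * X.map star = diagonal (fun i => (l i : ℂ)) := by
    have h := congrArg (fun M : Matrix (Fin 4) (Fin 4) ℂ => M.map (starRingEnd ℂ)) hd
    simp only [Matrix.map_mul] at h
    rw [show pauliYY.map (starRingEnd ℂ) = pauliYY from pauliYY_map_star] at h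
    rw [show Xᴴ = (Xᵀ).map (starRingEnd ℂ) from rfl, show X.map star = X.map (starRingEnd ℂ) from rfl,
      h, diagonal_map (map_zero _)]
    simp
  have hstar : ρ.map star = X.map star * Xᵀ := by
    have h : ρ.map (starRingEnd ℂ) = X.map (starRingEnd ℂ) * Xᴴ.map (starRingEnd ℂ) := by
      rw [hX, Matrix.map_mul]
    rw [show ρ.map star = ρ.map (starRingEnd ℂ) from rfl, h]
    congr 1
    ext i j; simp
  have hprod : ρ * spinFlip ρ = X * (Xᴴ * pauliYY * X.map star * (Xᵀ * pauliYY)) := by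
    rw [spinFlip_eq, hstar]
    nth_rewrite 1 [hX]
    simp only [Matrix.mul_assoc]
  have hchar : (ρ * spinFlip ρ).charpoly = (diagonal (fun i => (((l i) ^ 2 : ℝ) : ℂ))).charpoly := by
    have h := charpoly_mul_comm' X (Xᴴ * pauliYY * X.map star * (Xᵀ * pauliYY))
    rw [← hprod, Matrix.mul_assoc (Xᴴ * pauliYY * X.map star), hd', hd,
      diagonal_mul_diagonal] at h
    have hc : Fintype.card Idx = Fintype.card (Fin 4) := by simp
    rw [hc] at h
    rw [mul_left_cancel₀ (pow_ne_zero _ Polynomial.X_ne_zero) h]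
    congr 2
    funext i
    push_cast; ring
  rw [hchar, charpoly_diagonal, Polynomial.roots_prod _ _
    (Finset.prod_ne_zero_iff.2 fun i _ => Polynomial.X_sub_C_ne_zero _)]
  simp only [Polynomial.roots_X_sub_C]
  rw [Multiset.bind_singleton]

open scoped MatrixOrder in
theorem exists_eq_conjTranspose_mul_self {ι : Type*} [Fintype ι] [DecidableEq ι]
    {A : Matrix ι ι ℂ} (hA : A.PosSemidef) : ∃ B : Matrix ι ι ℂ, A = Bᴴ * B :=
  CStarAlgebra.nonneg_iff_eq_star_mul_self.1 hA.nonneg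

/-- A state has a decomposition whose matrix of spin-flip overlaps is diagonal with nonnegative
decreasing entries (Takagi factorization of those overlaps). -/
theorem exists_diagonal_decomposition {ρ : Matrix Idx Idx ℂ} (hρ : ρ.PosSemidef) :
    ∃ (X : Matrix Idx (Fin 4) ℂ) (l : Fin 4 → ℝ), ρ = X * Xᴴ ∧ (∀ i, 0 ≤ l i) ∧ Antitone l ∧
      Xᵀ * pauliYY * X = diagonal (fun i => (l i : ℂ)) := by
  obtain ⟨B, hB⟩ := exists_eq_conjTranspose_mul_self hρ
  obtain ⟨U, l, hU, hl, hanti, hd⟩ := exists_takagi (n := 4) (by simp)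
    (Bᴴᵀ * pauliYY * Bᴴ) (by simp [transpose_mul, pauliYY_transpose, Matrix.mul_assoc])
  refine ⟨Bᴴ * U, l, ?_, hl, hanti, ?_⟩
  · rw [conjTranspose_mul, conjTranspose_conjTranspose, Matrix.mul_assoc, ← Matrix.mul_assoc U, hU,
      Matrix.one_mul, hB]
  · rw [← hd, transpose_mul]
    simp only [Matrix.mul_assoc]

/-- Four sides with `l 0 ≥ l 1 ≥ l 2 ≥ l 3` can be arranged in the plane so as to close up, or to
leave the gap `l 0 - l 1 - l 2 - l 3` if that is positive. The directions are squares because the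
phases enter a symmetric bilinear form. -/
theorem exists_phases {l : Fin 4 → ℝ} (hanti : Antitone l) :
    ∃ ε : Fin 4 → ℂ, (∀ i, ‖ε i‖ = 1) ∧
      ‖∑ i, ε i ^ 2 * (l i : ℂ)‖ ≤ max 0 (l 0 - l 1 - l 2 - l 3) := by
  have h01 : l 1 ≤ l 0 := hanti (by decide)
  have h12 : l 2 ≤ l 1 := hanti (by decide)
  have h23 : l 3 ≤ l 2 := hanti (by decide)
  by_cases h : l 0 - l 1 - l 2 - l 3 ≤ 0
  · -- close up: the side `l 0 + e^{iθ} l 1` takes all lengths from `l 0 + l 1` to `l 0 - l 1`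
    have hcont : ContinuousOn (fun t : ℝ => ‖(l 0 : ℂ) + Complex.exp (t * Complex.I) * l 1‖)
        (Set.Icc 0 Real.pi) := by fun_prop
    have hmem : l 2 + l 3 ∈ Set.Icc ‖(l 0 : ℂ) + Complex.exp ((Real.pi : ℝ) * Complex.I) * l 1‖
        ‖(l 0 : ℂ) + Complex.exp ((0 : ℝ) * Complex.I) * l 1‖ := by
      rw [Complex.exp_pi_mul_I, Complex.ofReal_zero, zero_mul, Complex.exp_zero, one_mul,
        neg_one_mul, ← sub_eq_add_neg, ← Complex.ofReal_sub, ← Complex.ofReal_add,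
        Complex.norm_real, Complex.norm_real, Real.norm_eq_abs, Real.norm_eq_abs,
        abs_of_nonneg (by linarith), abs_of_nonneg (by linarith)]
      constructor <;> linarith
    obtain ⟨t, -, ht⟩ := intermediate_value_Icc' Real.pi_pos.le hcont hmem
    simp only at ht
    -- the remaining two sides point together, opposite to that sum
    obtain ⟨c, hc1, hc⟩ : ∃ c : ℂ, ‖c‖ = 1 ∧
        (l 0 : ℂ) + Complex.exp (t * Complex.I) * l 1 + c ^ 2 * (l 2 + l 3) = 0 := by
      set z := (l 0 : ℂ) + Complex.exp (t * Complex.I) * l 1 with hz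
      refine ⟨Complex.exp (((-z).arg / 2 : ℝ) * Complex.I), Complex.norm_exp_ofReal_mul_I _, ?_⟩
      rw [← Complex.exp_nat_mul]
      have h1 : ((2 : ℕ) : ℂ) * (((-z).arg / 2 : ℝ) * Complex.I) = (-z).arg * Complex.I := by
        push_cast; ring
      have h2 : ((l 2 : ℂ) + l 3) = (‖-z‖ : ℂ) := by
        rw [norm_neg, ht]; push_cast; ring
      rw [h1, h2, mul_comm, Complex.norm_mul_exp_arg_mul_I]
      ring
    refine ⟨![1, Complex.exp ((t / 2 : ℝ) * Complex.I), c, c], ?_, ?_⟩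
    · intro i
      fin_cases i
      · simp
      · exact Complex.norm_exp_ofReal_mul_I _
      · exact hc1
      · exact hc1
    · have h1 : Complex.exp ((t / 2 : ℝ) * Complex.I) ^ 2 = Complex.exp (t * Complex.I) := by
        rw [← Complex.exp_nat_mul]
        congr 1
        push_cast; ring
      have h0 : ∑ i, (![1, Complex.exp ((t / 2 : ℝ) * Complex.I), c, c] : Fin 4 → ℂ) i ^ 2 *
          (l i : ℂ) = 0 := by
        rw [Fin.sum_univ_four, ← hc]
        simp only [Matrix.cons_val]
        rw [h1]
        ring
      rw [h0, norm_zero]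
      exact le_max_left _ _
  · refine ⟨![1, Complex.I, Complex.I, Complex.I], fun i => by fin_cases i <;> simp, ?_⟩
    have h0 : ∑ i, (![1, Complex.I, Complex.I, Complex.I] : Fin 4 → ℂ) i ^ 2 * (l i : ℂ) =
        ((l 0 - l 1 - l 2 - l 3 : ℝ) : ℂ) := by
      rw [Fin.sum_univ_four]
      simp only [Matrix.cons_val, Complex.I_sq]
      push_cast; ring
    rw [h0, Complex.norm_real, Real.norm_eq_abs, abs_of_nonneg (by linarith)]
    exact le_max_right _ _

/-- **Wootters' decomposition**: `ρ` is a mixture of vectors whose pure-state concurrences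
`2 |det|` add up to at most the concurrence of `ρ`. After Takagi diagonalization and a choice of
phases, mixing with a `4 × 4` Hadamard matrix spreads the trace of the overlaps evenly. -/
theorem exists_wootters_decomposition {ρ : Matrix Idx Idx ℂ} (hρ : ρ.PosSemidef) :
    ∃ Y : Matrix Idx (Fin 4) ℂ, ρ = Y * Yᴴ ∧
      ∑ m, 2 * ‖qubitDet (fun a => Y a m)‖ ≤ concurrence ρ := by
  obtain ⟨X, l, hX, hl, hanti, hd⟩ := exists_diagonal_decomposition hρ
  obtain ⟨ε, hε, hsum⟩ := exists_phases hanti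
  let H : Matrix (Fin 4) (Fin 4) ℂ :=
    !![1, 1, 1, 1; 1, -1, 1, -1; 1, 1, -1, -1; 1, -1, -1, 1]
  let K : Matrix (Fin 4) (Fin 4) ℂ := of fun i m => (1 / 2 : ℂ) * ε i * H i m
  have hεε : ∀ i, ε i * star (ε i) = 1 := fun i => by
    rw [Complex.star_def, Complex.mul_conj, Complex.normSq_eq_norm_sq, hε]; simp
  have hK : K * Kᴴ = 1 := by
    ext i j
    simp only [mul_apply, conjTranspose_apply, Fin.sum_univ_four, K, of_apply]
    simp only [Complex.star_def] at hεε
    fin_cases i <;> fin_cases j <;> simp [H] <;> try ring1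
    · linear_combination hεε 0
    · linear_combination hεε 1
    · linear_combination hεε 2
    · linear_combination hεε 3
  refine ⟨X * K, ?_, ?_⟩
  · rw [conjTranspose_mul, Matrix.mul_assoc, ← Matrix.mul_assoc K, hK, Matrix.one_mul, hX]
  · rw [concurrence_eq_of_diagonal hX hl hanti hd]
    refine le_trans (le_of_eq ?_) hsum
    have hm : ∀ m, -2 * qubitDet (fun a => (X * K) a m) = (1 / 4 : ℂ) * ∑ i, ε i ^ 2 * (l i : ℂ) := by
      intro m
      rw [← dotProduct_pauliYY_mulVec]
      have h1 : (fun a => (X * K) a m) ⬝ᵥ (pauliYY *ᵥ (fun a => (X * K) a m)) =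
          (Kᵀ * (Xᵀ * pauliYY * X) * K) m m := by
        have h2 : Kᵀ * (Xᵀ * pauliYY * X) * K = (X * K)ᵀ * pauliYY * (X * K) := by
          rw [transpose_mul]; simp only [Matrix.mul_assoc]
        rw [h2, dotProduct_mulVec]; rfl
      rw [h1, hd, Matrix.mul_assoc]
      simp only [mul_apply, transpose_apply, Fin.sum_univ_four, K, of_apply]
      fin_cases m <;> simp [H] <;> ring
    have hm' : ∀ m, 2 * ‖qubitDet (fun a => (X * K) a m)‖ =
        (1 / 4) * ‖∑ i, ε i ^ 2 * (l i : ℂ)‖ := fun m => by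
      have h := congrArg norm (hm m)
      rw [norm_mul, norm_mul] at h
      simpa using h
    rw [Finset.sum_congr rfl fun m _ => hm' m]
    simp

/-! ### The partial transpose as a quadratic form -/

theorem partialTranspose_isHermitian {ρ : Matrix Idx Idx ℂ} (hρ : ρ.IsHermitian) :
    (partialTranspose ρ).IsHermitian := by
  ext a b
  exact hρ.apply _ _

/-- For a pure state `w` the partially transposed quadratic form at `v` is `tr (Z Z̄)` with
`Z = V† W`, and `|z₀₀|² + |z₁₁|² + 2 Re (z₀₁ z̄₁₀) ≥ 2 (|z₀₀ z₁₁| - |z₀₁ z₁₀|) ≥ -2 |det Z|`. -/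
theorem overlap_partialTranspose_vecMulVec (w v : Idx → ℂ) :
    -(2 * ‖qubitDet w‖ * ‖qubitDet v‖) ≤
      overlap (partialTranspose (vecMulVec w (star w))) v := by
  have key : ∀ p q r s : ℂ, -(2 * ‖p * s - q * r‖) ≤
      (p * star p + q * star r + r * star q + s * star s).re := by
    intro p q r s
    have h1 : (p * star p + q * star r + r * star q + s * star s).re =
        ‖p‖ ^ 2 + ‖s‖ ^ 2 + 2 * (q * star r).re := by
      rw [← Complex.normSq_eq_norm_sq, ← Complex.normSq_eq_norm_sq, Complex.normSq_apply,
        Complex.normSq_apply]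
      simp
      ring
    have h2 : -(‖q‖ * ‖r‖) ≤ (q * star r).re := by
      have h := Complex.abs_re_le_norm (q * star r)
      rw [norm_mul, norm_star] at h
      linarith [neg_abs_le (q * star r).re]
    have h3 : ‖q‖ * ‖r‖ - ‖p‖ * ‖s‖ ≤ ‖p * s - q * r‖ := by
      rw [← norm_mul, ← norm_mul, norm_sub_rev]
      exact norm_sub_norm_le _ _
    nlinarith [sq_nonneg (‖p‖ - ‖s‖)]
  let z : Fin 2 → Fin 2 → ℂ := fun i j => ∑ k, star (v (k, i)) * w (k, j)
  have hz : z 0 0 * z 1 1 - z 0 1 * z 1 0 = star (qubitDet v) * qubitDet w := by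
    simp [z, qubitDet]
    ring
  have h := key (z 0 0) (z 0 1) (z 1 0) (z 1 1)
  rw [hz, norm_mul, norm_star] at h
  have h4 : overlap (partialTranspose (vecMulVec w (star w))) v =
      (z 0 0 * star (z 0 0) + z 0 1 * star (z 1 0) + z 1 0 * star (z 0 1) +
        z 1 1 * star (z 1 1)).re := by
    rw [overlap]
    congr 1
    simp [dotProduct, mulVec, Fintype.sum_prod_type, partialTranspose, vecMulVec_apply, z]
    ring
  rw [h4]
  linarith

theorem overlap_partialTranspose_mul_conjTranspose {κ : Type*} [Fintype κ] (Y : Matrix Idx κ ℂ)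
    (v : Idx → ℂ) : overlap (partialTranspose (Y * Yᴴ)) v =
      ∑ m, overlap (partialTranspose
        (vecMulVec (fun a => Y a m) (star fun a => Y a m))) v := by
  have h : partialTranspose (Y * Yᴴ) =
      ∑ m, partialTranspose (vecMulVec (fun a => Y a m) (star fun a => Y a m)) := by
    ext a b
    simp [partialTranspose, mul_apply, Matrix.sum_apply, vecMulVec_apply]
  simp only [overlap]
  rw [h, Matrix.sum_mulVec, dotProduct_sum, Complex.re_sum]

/-- The concurrence bounds the negative values of the partially transposed form. This is where
negativity and concurrence meet. -/
theorem overlap_partialTranspose_ge {ρ : Matrix Idx Idx ℂ} (hρ : ρ.PosSemidef) (v : Idx → ℂ) :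
    -(concurrence ρ * ‖qubitDet v‖) ≤ overlap (partialTranspose ρ) v := by
  obtain ⟨Y, hY, hC⟩ := exists_wootters_decomposition hρ
  have h : overlap (partialTranspose ρ) v = ∑ m, overlap (partialTranspose
        (vecMulVec (fun a => Y a m) (star fun a => Y a m))) v := by
    rw [← overlap_partialTranspose_mul_conjTranspose, ← hY]
  rw [h]
  calc -(concurrence ρ * ‖qubitDet v‖)
      ≤ -((∑ m, 2 * ‖qubitDet (fun a => Y a m)‖) * ‖qubitDet v‖) := by gcongr
    _ = ∑ m, -(2 * ‖qubitDet (fun a => Y a m)‖ * ‖qubitDet v‖) := by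
        rw [Finset.sum_mul, Finset.sum_neg_distrib]
    _ ≤ _ := Finset.sum_le_sum fun m _ => overlap_partialTranspose_vecMulVec _ _

theorem star_dotProduct_self_eq (v : Idx → ℂ) : star v ⬝ᵥ v =
    ((‖v (0, 0)‖ ^ 2 + ‖v (0, 1)‖ ^ 2 + (‖v (1, 0)‖ ^ 2 + ‖v (1, 1)‖ ^ 2) : ℝ) : ℂ) := by
  simp [dotProduct, Fintype.sum_prod_type, ← Complex.conj_mul']

theorem overlap_eq_of_mulVec_eq {A : Matrix Idx Idx ℂ} {v : Idx → ℂ} {x : ℝ}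
    (hv : star v ⬝ᵥ v = 1) (h : A *ᵥ v = (x : ℂ) • v) : overlap A v = x := by
  rw [overlap, h, dotProduct_smul, hv]
  simp

/-- The squared norms of the rows of `V`, the inner product of the rows and the determinant are
related by `|r₀|² |r₁|² = |det V|² + |⟨r₁, r₀⟩|²`. -/
theorem normSq_rows (a b c d : ℂ) : (‖a‖ ^ 2 + ‖b‖ ^ 2) * (‖c‖ ^ 2 + ‖d‖ ^ 2) =
    ‖a * d - b * c‖ ^ 2 + ‖a * star c + b * star d‖ ^ 2 := by
  apply Complex.ofReal_injective
  push_cast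
  simp only [← Complex.conj_mul']
  simp
  ring

/-- Among unit vectors `2 |det|` is at most `1`. -/
theorem two_mul_norm_qubitDet_le {v : Idx → ℂ} (hv : star v ⬝ᵥ v = 1) : 2 * ‖qubitDet v‖ ≤ 1 := by
  rw [star_dotProduct_self_eq] at hv
  have h1 := Complex.ofReal_injective (hv.trans Complex.ofReal_one.symm)
  have h2 := normSq_rows (v (0, 0)) (v (0, 1)) (v (1, 0)) (v (1, 1))
  rw [← qubitDet] at h2
  set p := ‖v (0, 0)‖ ^ 2 + ‖v (0, 1)‖ ^ 2
  set q := ‖v (1, 0)‖ ^ 2 + ‖v (1, 1)‖ ^ 2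
  have h3 := sq_nonneg ‖v (0, 0) * star (v (1, 0)) + v (0, 1) * star (v (1, 1))‖
  have h4 := norm_nonneg (qubitDet v)
  nlinarith [sq_nonneg (p - q)]

/-- A unit vector attaining the bound `2 |det| ≤ 1` is maximally entangled. -/
theorem isMaxEntangled_of_le_norm_qubitDet {v : Idx → ℂ} (hv : star v ⬝ᵥ v = 1)
    (hd : 1 ≤ 2 * ‖qubitDet v‖) : IsMaxEntangled v := by
  rw [star_dotProduct_self_eq] at hv
  have h1 := Complex.ofReal_injective (hv.trans Complex.ofReal_one.symm)
  have h2 := normSq_rows (v (0, 0)) (v (0, 1)) (v (1, 0)) (v (1, 1))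
  rw [← qubitDet] at h2
  have h5 : reducedState v 0 0 = ((‖v (0, 0)‖ ^ 2 + ‖v (0, 1)‖ ^ 2 : ℝ) : ℂ) := by
    simp [reducedState, ← Complex.mul_conj']
  have h6 : reducedState v 1 1 = ((‖v (1, 0)‖ ^ 2 + ‖v (1, 1)‖ ^ 2 : ℝ) : ℂ) := by
    simp [reducedState, ← Complex.mul_conj']
  have h7 : reducedState v 0 1 = v (0, 0) * star (v (1, 0)) + v (0, 1) * star (v (1, 1)) := by
    simp [reducedState]
  have h8 : reducedState v 1 0 = star (reducedState v 0 1) := by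
    simp [reducedState, mul_comm]
  rw [← h7] at h2
  set p := ‖v (0, 0)‖ ^ 2 + ‖v (0, 1)‖ ^ 2
  set q := ‖v (1, 0)‖ ^ 2 + ‖v (1, 1)‖ ^ 2
  have h9 : (p - q) ^ 2 + 4 * ‖reducedState v 0 1‖ ^ 2 ≤ 0 := by nlinarith
  have hpq : p - q = 0 := by
    apply pow_eq_zero_iff (two_ne_zero) |>.1
    nlinarith [sq_nonneg (p - q), sq_nonneg ‖reducedState v 0 1‖]
  have h01 : reducedState v 0 1 = 0 := by
    rw [← norm_eq_zero]
    apply pow_eq_zero_iff (two_ne_zero) |>.1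
    nlinarith [sq_nonneg (p - q), sq_nonneg ‖reducedState v 0 1‖]
  have hp : p = 1 / 2 := by linarith
  have hq : q = 1 / 2 := by linarith
  rw [IsMaxEntangled]
  ext i k
  fin_cases i <;> fin_cases k
  · simp [h5, hp]
  · simp [h01]
  · simp [h8, h01]
  · simp [h6, hq]

theorem IsMaxEntangled.star_dotProduct_self {v : Idx → ℂ} (hv : IsMaxEntangled v) :
    star v ⬝ᵥ v = 1 := by
  have h := congrArg Matrix.trace hv
  simp [Matrix.trace, reducedState] at h
  rw [← h]
  simp [dotProduct, Fintype.sum_prod_type, mul_comm]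

/-! ### Negative eigenvalues of the partial transpose -/

/-- Every plane of two-qubit vectors contains a nonzero product vector: the determinant restricted
to the plane is a binary quadratic form, which has a root over `ℂ`. -/
theorem exists_qubitDet_combination_eq_zero (v w : Idx → ℂ) :
    ∃ a b : ℂ, (a ≠ 0 ∨ b ≠ 0) ∧ qubitDet (a • v + b • w) = 0 := by
  by_cases hv : qubitDet v = 0
  · exact ⟨1, 0, Or.inl one_ne_zero, by simpa using hv⟩
  · let m := v (0, 0) * w (1, 1) + w (0, 0) * v (1, 1) - v (0, 1) * w (1, 0) - w (0, 1) * v (1, 0)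
    obtain ⟨s, hs⟩ := IsAlgClosed.exists_pow_nat_eq (discrim (qubitDet v) m (qubitDet w))
      (n := 2) (by norm_num)
    obtain ⟨x, hx⟩ := exists_quadratic_eq_zero hv ⟨s, by rw [← hs, sq]⟩
    refine ⟨x, 1, Or.inr one_ne_zero, ?_⟩
    rw [← hx]
    simp [qubitDet, m]
    ring

theorem overlap_partialTranspose_nonneg_of_qubitDet {ρ : Matrix Idx Idx ℂ} (hρ : ρ.PosSemidef)
    {v : Idx → ℂ} (hv : qubitDet v = 0) : 0 ≤ overlap (partialTranspose ρ) v := by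
  simpa [hv] using overlap_partialTranspose_ge hρ v

theorem star_dotProduct_eq_zero_of_eigenvalue_ne {A : Matrix Idx Idx ℂ} (hA : A.IsHermitian)
    {v w : Idx → ℂ} {x y : ℝ} (hv : A *ᵥ v = (x : ℂ) • v) (hw : A *ᵥ w = (y : ℂ) • w)
    (hxy : x ≠ y) : star v ⬝ᵥ w = 0 := by
  have h1 : star v ⬝ᵥ (A *ᵥ w) = star (A *ᵥ v) ⬝ᵥ w := by
    rw [star_mulVec, hA.eq, dotProduct_mulVec]
  rw [hv, hw, dotProduct_smul, star_smul, smul_dotProduct] at h1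
  simp only [smul_eq_mul, Complex.star_def, Complex.conj_ofReal] at h1
  have h2 : ((y : ℂ) - x) * (star v ⬝ᵥ w) = 0 := by linear_combination h1
  rcases mul_eq_zero.1 h2 with h | h
  · exact absurd (by exact_mod_cast (sub_eq_zero.1 h).symm) hxy
  · exact h

/-- On a combination of two orthogonal eigenvectors the quadratic form is the weighted sum of the
eigenvalues. -/
theorem overlap_combination {A : Matrix Idx Idx ℂ} {v w : Idx → ℂ} {x y : ℝ}
    (hv : A *ᵥ v = (x : ℂ) • v) (hw : A *ᵥ w = (y : ℂ) • w) (hvv : star v ⬝ᵥ v = 1)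
    (hww : star w ⬝ᵥ w = 1) (hvw : star v ⬝ᵥ w = 0) (a b : ℂ) :
    overlap A (a • v + b • w) = x * ‖a‖ ^ 2 + y * ‖b‖ ^ 2 := by
  have hwv : star w ⬝ᵥ v = 0 := by
    rw [star_dotProduct, hvw, star_zero]
  rw [overlap, mulVec_add, mulVec_smul, mulVec_smul, hv, hw]
  simp only [star_add, star_smul, add_dotProduct, dotProduct_add, smul_dotProduct,
    dotProduct_smul, hvv, hww, hvw, hwv, smul_eq_mul]
  rw [← Complex.normSq_eq_norm_sq, ← Complex.normSq_eq_norm_sq, Complex.normSq_apply,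
    Complex.normSq_apply]
  simp
  ring

theorem exists_normalize {v : Idx → ℂ} (hv : v ≠ 0) :
    ∃ c : ℂ, star (c • v) ⬝ᵥ (c • v) = 1 := by
  have h0 : star v ⬝ᵥ v ≠ 0 := fun h => hv (dotProduct_star_self_eq_zero.1 h)
  rw [star_dotProduct_self_eq] at h0
  set r := ‖v (0, 0)‖ ^ 2 + ‖v (0, 1)‖ ^ 2 + (‖v (1, 0)‖ ^ 2 + ‖v (1, 1)‖ ^ 2) with hr
  have hr0 : r ≠ 0 := by exact_mod_cast h0
  have hrpos : 0 < r := lt_of_le_of_ne (by positivity) hr0.symm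
  refine ⟨((√r)⁻¹ : ℝ), ?_⟩
  rw [star_smul, smul_dotProduct, dotProduct_smul, star_dotProduct_self_eq, ← hr]
  simp only [smul_eq_mul, Complex.star_def, Complex.conj_ofReal]
  rw [← Complex.ofReal_mul, ← Complex.ofReal_mul, ← Complex.ofReal_one]
  congr 1
  have h := Real.mul_self_sqrt hrpos.le
  have h' := (Real.sqrt_pos.2 hrpos).ne'
  field_simp
  nlinarith

/-- Two orthogonal unit eigenvectors of the partial transpose do not both have negative
eigenvalues, since the plane they span contains a product vector. -/
theorem not_both_neg {ρ : Matrix Idx Idx ℂ} (hρ : ρ.PosSemidef)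
    {v w : Idx → ℂ} {x y : ℝ} (hx : x < 0) (hy : y < 0)
    (hv : partialTranspose ρ *ᵥ v = (x : ℂ) • v) (hw : partialTranspose ρ *ᵥ w = (y : ℂ) • w)
    (hvv : star v ⬝ᵥ v = 1) (hww : star w ⬝ᵥ w = 1) (hvw : star v ⬝ᵥ w = 0) : False := by
  obtain ⟨a, b, hab, h0⟩ := exists_qubitDet_combination_eq_zero v w
  have h := overlap_partialTranspose_nonneg_of_qubitDet hρ h0
  rw [overlap_combination hv hw hvv hww hvw] at h
  rcases hab with ha | hb
  · have := norm_pos_iff.2 ha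
    nlinarith [mul_pos (neg_pos.2 hx) (pow_pos this 2),
      mul_nonneg (neg_pos.2 hy).le (sq_nonneg ‖b‖)]
  · have := norm_pos_iff.2 hb
    nlinarith [mul_pos (neg_pos.2 hy) (pow_pos this 2),
      mul_nonneg (neg_pos.2 hx).le (sq_nonneg ‖a‖)]

/-- The partial transpose has at most one negative eigenvalue, and it is simple. -/
theorem negative_eigenvector_unique {ρ : Matrix Idx Idx ℂ} (hρ : ρ.PosSemidef)
    {v w : Idx → ℂ} {x y : ℝ} (hx : x < 0) (hy : y < 0) (hvv : star v ⬝ᵥ v = 1) (hw0 : w ≠ 0)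
    (hv : partialTranspose ρ *ᵥ v = (x : ℂ) • v) (hw : partialTranspose ρ *ᵥ w = (y : ℂ) • w) :
    y = x ∧ ∃ c : ℂ, w = c • v := by
  have hH := partialTranspose_isHermitian hρ.isHermitian
  -- normalize any eigenvector orthogonal to `v` and compare
  have horth : ∀ {u : Idx → ℂ}, u ≠ 0 → partialTranspose ρ *ᵥ u = (y : ℂ) • u →
      star v ⬝ᵥ u = 0 → False := by
    intro u hu0 hu huv
    obtain ⟨c, hc⟩ := exists_normalize hu0
    refine not_both_neg hρ hx hy hv (w := c • u) ?_ hvv hc ?_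
    · rw [mulVec_smul, hu, smul_comm]
    · rw [dotProduct_smul, huv, smul_zero]
  have hyx : y = x := by
    by_contra hne
    exact horth hw0 hw (star_dotProduct_eq_zero_of_eigenvalue_ne hH hv hw (Ne.symm hne))
  refine ⟨hyx, star v ⬝ᵥ w, ?_⟩
  by_contra hne
  refine horth (u := w - (star v ⬝ᵥ w) • v) (sub_ne_zero.2 hne) ?_ ?_
  · rw [mulVec_sub, mulVec_smul, hw, hv, hyx, smul_sub, smul_comm (x : ℂ)]
  · rw [dotProduct_sub, dotProduct_smul, hvv]
    simp

/-! ### Partial transposes of maximally entangled projections -/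

/-- `(1 ⊗ i σ_y) v`, the vector `v` with the second qubit rotated. -/
def flipSecond (v : Idx → ℂ) : Idx → ℂ := fun a => if a.2 = 0 then v (a.1, 1) else -v (a.1, 0)

theorem flipSecond_flipSecond (v : Idx → ℂ) : flipSecond (flipSecond v) = -v := by
  ext ⟨i, j⟩
  fin_cases j <;> simp [flipSecond]

theorem reducedState_flipSecond (v : Idx → ℂ) : reducedState (flipSecond v) = reducedState v := by
  ext i k
  simp [reducedState, flipSecond]
  ring

theorem IsMaxEntangled.flipSecond {v : Idx → ℂ} (hv : IsMaxEntangled v) :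
    IsMaxEntangled (flipSecond v) := by
  rw [IsMaxEntangled, reducedState_flipSecond, hv]

/-- The matrix identity behind this is `(v v†)^Γ + u u† = 1 / 2` for maximally entangled `v`, with
`u = flipSecond v`. -/
theorem IsMaxEntangled.overlap_flipSecond {v : Idx → ℂ} (hv : IsMaxEntangled v)
    {ρ : Matrix Idx Idx ℂ} (hρ : ρ.trace = 1) :
    overlap ρ (TwoQubit.flipSecond v) = 1 / 2 - overlap (partialTranspose ρ) v := by
  have h := fun i k => congrFun (congrFun hv i) k
  simp only [reducedState, of_apply, Fin.sum_univ_two, Matrix.smul_apply, one_apply, smul_eq_mul] at h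
  have h00 := h 0 0
  have h01 := h 0 1
  have h10 := h 1 0
  have h11 := h 1 1
  simp at h00 h01 h10 h11
  rw [eq_sub_iff_add_eq, overlap, overlap, ← Complex.add_re]
  suffices hs : star (TwoQubit.flipSecond v) ⬝ᵥ (ρ *ᵥ TwoQubit.flipSecond v) +
      star v ⬝ᵥ (partialTranspose ρ *ᵥ v) = 1 / 2 by
    rw [hs]; norm_num
  have ht : ρ (0, 0) (0, 0) + ρ (0, 1) (0, 1) + (ρ (1, 0) (1, 0) + ρ (1, 1) (1, 1)) = 1 := by
    rw [← hρ]
    simp [Matrix.trace, Fintype.sum_prod_type]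
  simp [dotProduct, mulVec, Fintype.sum_prod_type, partialTranspose, TwoQubit.flipSecond]
  linear_combination (ρ (0, 0) (0, 0) + ρ (0, 1) (0, 1)) * h00 +
    (ρ (1, 0) (1, 0) + ρ (1, 1) (1, 1)) * h11 + (ρ (0, 0) (1, 0) + ρ (0, 1) (1, 1)) * h10 +
    (ρ (1, 0) (0, 0) + ρ (1, 1) (0, 1)) * h01 + (1 / 2) * ht

/-! ### The concurrence at a maximally entangled eigenvector -/

/-- The concurrence is invariant under a unitary rotation of the second qubit. -/
theorem concurrence_conj_kronecker {A : Matrix (Fin 2) (Fin 2) ℂ} (hA : A * Aᴴ = 1)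
    (ρ : Matrix Idx Idx ℂ) :
    concurrence (kroneckerMap (· * ·) 1 A * ρ * (kroneckerMap (· * ·) 1 A)ᴴ) = concurrence ρ := by
  set G : Matrix Idx Idx ℂ := kroneckerMap (· * ·) 1 A with hG
  have hdet : star A.det * A.det = 1 := by
    have h := congrArg Matrix.det hA
    rwa [det_mul, det_conjTranspose, det_one, mul_comm] at h
  have hS : Gᵀ * pauliYY * G = A.det • pauliYY := by
    ext ⟨i, j⟩ ⟨k, l⟩
    simp only [mul_apply, Fintype.sum_prod_type, Fin.sum_univ_two, transpose_apply, G, pauliYY,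
      kroneckerMap_apply, Matrix.smul_apply, smul_eq_mul, det_fin_two, pauliY, one_apply]
    fin_cases i <;> fin_cases j <;> fin_cases k <;> fin_cases l <;> simp <;> ring
  have hS' : Gᴴ * pauliYY * G.map star = star A.det • pauliYY := by
    have h := congrArg (fun M : Matrix Idx Idx ℂ => M.map (starRingEnd ℂ)) hS
    simp only [Matrix.map_mul] at h
    rw [show pauliYY.map (starRingEnd ℂ) = pauliYY from pauliYY_map_star] at h
    rw [show Gᴴ = (Gᵀ).map (starRingEnd ℂ) from rfl, show G.map star = G.map (starRingEnd ℂ) from rfl,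
      h]
    conv_rhs => rw [← pauliYY_map_star]
    ext a b
    simp
  have hstar : (G * ρ * Gᴴ).map star = G.map star * ρ.map star * Gᵀ := by
    have h : (G * ρ * Gᴴ).map (starRingEnd ℂ) =
        G.map (starRingEnd ℂ) * ρ.map (starRingEnd ℂ) * Gᴴ.map (starRingEnd ℂ) := by
      rw [Matrix.map_mul, Matrix.map_mul]
    rw [show (G * ρ * Gᴴ).map star = (G * ρ * Gᴴ).map (starRingEnd ℂ) from rfl, h]
    congr 1
    ext i j; simp
  have hchar : (G * ρ * Gᴴ * spinFlip (G * ρ * Gᴴ)).charpoly = (ρ * spinFlip ρ).charpoly := by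
    have h1 : G * ρ * Gᴴ * spinFlip (G * ρ * Gᴴ) =
        G * (ρ * (Gᴴ * pauliYY * G.map star) * ρ.map star * (Gᵀ * pauliYY)) := by
      rw [spinFlip_eq, hstar]
      simp only [Matrix.mul_assoc]
    have h2 : ρ * (Gᴴ * pauliYY * G.map star) * ρ.map star * (Gᵀ * pauliYY) * G =
        ρ * spinFlip ρ := by
      rw [Matrix.mul_assoc _ (Gᵀ * pauliYY) G, hS, hS', spinFlip_eq]
      simp only [Matrix.mul_smul, Matrix.smul_mul, smul_smul, mul_comm A.det, hdet, one_smul,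
        Matrix.mul_assoc]
    rw [h1, charpoly_mul_comm, h2]
  rw [concurrence, concurrence, woottersList, woottersList, hchar]

/-- The operator exchanging the two qubits. -/
def swapMatrix : Matrix Idx Idx ℂ := of fun a b => if a.1 = b.2 ∧ a.2 = b.1 then 1 else 0

theorem swapMatrix_conjTranspose : swapMatrixᴴ = swapMatrix := by
  ext a b
  simp only [conjTranspose_apply, swapMatrix, of_apply]
  rw [apply_ite star, star_one, star_zero]
  simp only [eq_comm, and_comm]

theorem swapMatrix_mulVec (v : Idx → ℂ) : swapMatrix *ᵥ v = fun a => v (a.2, a.1) := by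
  ext ⟨i, j⟩
  simp only [mulVec, dotProduct, Fintype.sum_prod_type, Fin.sum_univ_two, swapMatrix, of_apply]
  fin_cases i <;> fin_cases j <;> simp

/-- When the contraction `∑ m, ⟨i m|r|m n⟩` is scalar, which says that `∑ i, |i i⟩` is an
eigenvector of the partial transpose, the spin flip of `r` is conjugation by the swap. -/
theorem spinFlip_eq_swap_conj {r : Matrix Idx Idx ℂ} (hr : r.IsHermitian) {x : ℝ}
    (hx : ∀ i n, ∑ m, r (i, m) (m, n) = if i = n then (x : ℂ) else 0) :
    spinFlip r = swapMatrix * r * swapMatrix := by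
  have hs : ∀ a b, star (r a b) = r b a := fun a b => hr.apply b a
  simp only [Fin.sum_univ_two] at hx
  have h00 := hx 0 0
  have h01 := hx 0 1
  have h10 := hx 1 0
  have h11 := hx 1 1
  have k00 := congrArg star h00
  have k01 := congrArg star h01
  have k10 := congrArg star h10
  have k11 := congrArg star h11
  simp [-RCLike.star_def, hs] at h00 h01 h10 h11 k00 k01 k10 k11
  ext ⟨i, j⟩ ⟨k, l⟩
  rw [spinFlip_eq]
  simp only [mul_apply, Fintype.sum_prod_type, Fin.sum_univ_two, pauliYY, kroneckerMap_apply,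
    swapMatrix, of_apply, map_apply, hs, pauliY]
  fin_cases i <;> fin_cases j <;> fin_cases k <;> fin_cases l <;> simp
  · linear_combination k11 - h00
  · linear_combination -k10
  · linear_combination -h01
  · linear_combination -h10
  · linear_combination h00 - k00
  · linear_combination -k10
  · linear_combination -k01
  · linear_combination k00 - h00
  · linear_combination -h01
  · linear_combination -h10
  · linear_combination -k01
  · linear_combination h00 - k11

/-- Spectral data of a Hermitian matrix listed in decreasing order, together with the
characteristic polynomial of its square. -/
theorem exists_sorted_eigenvectors {H : Matrix Idx Idx ℂ} (hH : H.IsHermitian) :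
    ∃ (μ : Fin 4 → ℝ) (e : Fin 4 → Idx → ℂ), Antitone μ ∧
      (∀ i, H *ᵥ e i = (μ i : ℂ) • e i) ∧
      (∀ i j, star (e i) ⬝ᵥ e j = if i = j then 1 else 0) ∧
      H.trace = ∑ i, (μ i : ℂ) ∧
      (H * H).charpoly.roots = Finset.univ.val.map (fun i => (((μ i) ^ 2 : ℝ) : ℂ)) := by
  let f : Fin 4 ≃ Idx := (Fintype.equivFinOfCardEq (by simp)).symm
  let s : Fin 4 ≃ Idx := (Tuple.sort (fun i => -hH.eigenvalues (f i))).trans f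
  refine ⟨fun i => hH.eigenvalues (s i), fun i => (hH.eigenvectorBasis (s i)).ofLp, ?_, ?_, ?_,
    ?_, ?_⟩
  · intro i j hij
    have := Tuple.monotone_sort (fun i => -hH.eigenvalues (f i)) hij
    simpa [s] using this
  · intro i
    rw [hH.mulVec_eigenvectorBasis]
    ext a
    simp
  · intro i j
    have h := orthonormal_iff_ite.1 hH.eigenvectorBasis.orthonormal (s i) (s j)
    rw [EuclideanSpace.inner_eq_star_dotProduct] at h
    rw [dotProduct_comm, h]
    simp only [s.injective.eq_iff]
  · rw [hH.trace_eq_sum_eigenvalues, ← s.sum_comp]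
    rfl
  · have hchar : (H * H).charpoly =
        (diagonal (fun a => (((hH.eigenvalues a) ^ 2 : ℝ) : ℂ))).charpoly := by
      have h : H * H = hH.eigenvectorUnitary.1 * (diagonal (fun a =>
          (((hH.eigenvalues a) ^ 2 : ℝ) : ℂ)) * star hH.eigenvectorUnitary.1) := by
        conv_lhs => rw [hH.spectral_theorem, ← map_mul, diagonal_mul_diagonal]
        rw [Unitary.conjStarAlgAut_apply, Matrix.mul_assoc]
        congr 3
        funext a
        simp [sq]
      rw [h, charpoly_mul_comm, Matrix.mul_assoc, Unitary.coe_star_mul_self, Matrix.mul_one]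
    rw [hchar, charpoly_diagonal, ← s.prod_comp, Polynomial.roots_prod _ _
      (Finset.prod_ne_zero_iff.2 fun i _ => Polynomial.X_sub_C_ne_zero _)]
    simp only [Polynomial.roots_X_sub_C]
    rw [Multiset.bind_singleton]

theorem overlap_conj (B M : Matrix Idx Idx ℂ) (x : Idx → ℂ) :
    overlap (B * M * Bᴴ) x = overlap M (Bᴴ *ᵥ x) := by
  rw [overlap, overlap, ← mulVec_mulVec, ← mulVec_mulVec, star_mulVec, conjTranspose_conjTranspose,
    ← dotProduct_mulVec]

/-- The swap is positive on symmetric vectors. -/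
theorem overlap_swapMatrix_nonneg {y : Idx → ℂ} (hy : y (0, 1) = y (1, 0)) :
    0 ≤ overlap swapMatrix y := by
  have h : swapMatrix *ᵥ y = y := by
    rw [swapMatrix_mulVec]
    ext ⟨i, j⟩
    fin_cases i <;> fin_cases j <;> simp [hy]
  rw [overlap, h, star_dotProduct_self_eq, Complex.ofReal_re]
  positivity

/-- In the normal form `spinFlip r = W r W` with `W` the swap, the square roots of the eigenvalues
of `r * spinFlip r` are the moduli of the eigenvalues of the Hermitian matrix `B W Bᴴ`, where
`r = Bᴴ B`. As `W` has a single negative eigenvalue, so has `B W Bᴴ` at most one, and if the trace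
is not positive this one dominates and the concurrence is minus the trace. -/
theorem concurrence_eq_of_swap_conj {r : Matrix Idx Idx ℂ} (hr : r.PosSemidef)
    (hflip : spinFlip r = swapMatrix * r * swapMatrix) {t : ℝ} (ht : (r * swapMatrix).trace = t)
    (ht0 : t ≤ 0) : concurrence r = -t := by
  obtain ⟨B, hB⟩ := exists_eq_conjTranspose_mul_self hr
  have hH : (B * swapMatrix * Bᴴ).IsHermitian := by
    rw [IsHermitian, conjTranspose_mul, conjTranspose_mul, conjTranspose_conjTranspose,
      swapMatrix_conjTranspose, Matrix.mul_assoc]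
  obtain ⟨μ, e, hanti, heig, hort, htr, hroots⟩ := exists_sorted_eigenvectors hH
  have hchar : (r * spinFlip r).charpoly =
      (B * swapMatrix * Bᴴ * (B * swapMatrix * Bᴴ)).charpoly := by
    have h1 : r * spinFlip r = Bᴴ * (B * swapMatrix * Bᴴ * (B * swapMatrix)) := by
      rw [hflip, hB]
      simp only [Matrix.mul_assoc]
    rw [h1, charpoly_mul_comm]
    simp only [Matrix.mul_assoc]
  have hsum : μ 0 + μ 1 + μ 2 + μ 3 = t := by
    have h : (B * swapMatrix * Bᴴ).trace = t := by
      rw [← ht, hB, Matrix.mul_assoc, trace_mul_comm, Matrix.mul_assoc, trace_mul_comm,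
        Matrix.mul_assoc, trace_mul_comm]
    rw [h, Fin.sum_univ_four] at htr
    exact_mod_cast htr.symm
  have h23 : μ 3 ≤ μ 2 := hanti (by decide)
  have h12 : μ 2 ≤ μ 1 := hanti (by decide)
  have h01 : μ 1 ≤ μ 0 := hanti (by decide)
  -- otherwise the plane of `e 2` and `e 3` contains a vector mapped by `Bᴴ` to a symmetric one
  have hpos : 0 ≤ μ 2 := by
    by_contra hneg
    push Not at hneg
    obtain ⟨a, b, hab, h0⟩ : ∃ a b : ℂ, (a ≠ 0 ∨ b ≠ 0) ∧
        (Bᴴ *ᵥ (a • e 2 + b • e 3)) (0, 1) = (Bᴴ *ᵥ (a • e 2 + b • e 3)) (1, 0) := by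
      simp only [mulVec_add, mulVec_smul, Pi.add_apply, Pi.smul_apply, smul_eq_mul]
      by_cases h : (Bᴴ *ᵥ e 2) (0, 1) = (Bᴴ *ᵥ e 2) (1, 0)
      · exact ⟨1, 0, Or.inl one_ne_zero, by rw [h]; ring⟩
      · exact ⟨(Bᴴ *ᵥ e 3) (0, 1) - (Bᴴ *ᵥ e 3) (1, 0), -((Bᴴ *ᵥ e 2) (0, 1) - (Bᴴ *ᵥ e 2) (1, 0)),
          Or.inr (neg_ne_zero.2 (sub_ne_zero.2 h)), by ring⟩
    have h := overlap_swapMatrix_nonneg h0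
    rw [← overlap_conj, overlap_combination (heig 2) (heig 3) (by simp [hort]) (by simp [hort])
      (by simp [hort])] at h
    have h3 : μ 3 < 0 := by linarith
    rcases hab with ha | hb
    · have := norm_pos_iff.2 ha
      nlinarith [mul_pos (neg_pos.2 hneg) (pow_pos this 2),
        mul_nonneg (neg_pos.2 h3).le (sq_nonneg ‖b‖)]
    · have := norm_pos_iff.2 hb
      nlinarith [mul_pos (neg_pos.2 h3) (pow_pos this 2),
        mul_nonneg (neg_pos.2 hneg).le (sq_nonneg ‖a‖)]
  have hC : concurrence r = max 0 (-μ 3 - μ 0 - μ 1 - μ 2) := by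
    refine concurrence_eq_of_roots (a := ![-μ 3, μ 0, μ 1, μ 2]) ?_ ?_ ?_
    · intro i
      fin_cases i <;> simp <;> linarith
    · refine Fin.antitone_iff_succ_le.2 fun i => ?_
      fin_cases i
      · show μ 0 ≤ -μ 3
        linarith
      · exact h01
      · exact h12
    · rw [hchar, hroots]
      change ((([μ 0, μ 1, μ 2] ++ [μ 3]).map fun y => ((y ^ 2 : ℝ) : ℂ) : List ℂ) : Multiset ℂ) =
        (([-μ 3] ++ [μ 0, μ 1, μ 2]).map fun y => ((y ^ 2 : ℝ) : ℂ) : List ℂ)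
      refine Multiset.coe_eq_coe.2 ?_
      rw [List.map_append, List.map_append, List.map_singleton, List.map_singleton, neg_sq]
      exact List.perm_append_comm
  rw [hC, max_eq_right (by linarith)]
  linarith

/-- If a maximally entangled vector is an eigenvector of `ρ^Γ` for the eigenvalue `x ≤ 0`, then
the concurrence is `-2 x`. A rotation of the second qubit turns the vector into
`(|00⟩ + |11⟩) / √2`, where the normal form of the spin flip is available. -/
theorem IsMaxEntangled.concurrence_eq {ρ : Matrix Idx Idx ℂ} (hρ : ρ.PosSemidef) {v : Idx → ℂ}
    (hv : IsMaxEntangled v) {x : ℝ} (hx : x ≤ 0)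
    (h : partialTranspose ρ *ᵥ v = (x : ℂ) • v) : concurrence ρ = -2 * x := by
  set s : ℂ := ((√2 : ℝ) : ℂ) with hs
  have hss : s * s = 2 := by
    rw [hs, ← Complex.ofReal_mul, Real.mul_self_sqrt (by norm_num)]; norm_num
  have hsc : (starRingEnd ℂ) s = s := Complex.conj_ofReal _
  have hv' : ∀ i k, v (i, 0) * star (v (k, 0)) + v (i, 1) * star (v (k, 1)) =
      if i = k then (1 / 2 : ℂ) else 0 := fun i k => by
    have h := congrFun (congrFun hv i) k
    simp only [reducedState, of_apply, Fin.sum_univ_two] at h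
    rw [h]
    simp [one_apply]
  let A : Matrix (Fin 2) (Fin 2) ℂ := of fun l m => s * star (v (m, l))
  have hA : Aᴴ * A = 1 := by
    ext m n
    simp only [mul_apply, Fin.sum_univ_two, conjTranspose_apply, A, of_apply, star_mul', star_star]
    have h := hv' m n
    rw [one_apply]
    simp only [Complex.star_def] at h ⊢
    rw [hsc]
    split_ifs at h ⊢ with hmn
    · linear_combination 2 * h + (v (m, 0) * (starRingEnd ℂ) (v (n, 0)) +
        v (m, 1) * (starRingEnd ℂ) (v (n, 1))) * hss
    · linear_combination 2 * h + (v (m, 0) * (starRingEnd ℂ) (v (n, 0)) +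
        v (m, 1) * (starRingEnd ℂ) (v (n, 1))) * hss
  set G : Matrix Idx Idx ℂ := kroneckerMap (· * ·) 1 Aᴴ with hG
  have hC : concurrence (G * ρ * Gᴴ) = concurrence ρ :=
    concurrence_conj_kronecker (by rwa [conjTranspose_conjTranspose]) ρ
  have hr : (G * ρ * Gᴴ).PosSemidef := hρ.mul_mul_conjTranspose_same G
  have hcontr : ∀ i n, ∑ m, (G * ρ * Gᴴ) (i, m) (m, n) = if i = n then (x : ℂ) else 0 := by
    intro i n
    have h0 := congrFun h (i, 0)
    have h1 := congrFun h (i, 1)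
    simp only [mulVec, dotProduct, Fintype.sum_prod_type, Fin.sum_univ_two, partialTranspose,
      of_apply, Pi.smul_apply, smul_eq_mul] at h0 h1
    have hin := hv' i n
    simp only [Fin.sum_univ_two, mul_apply, Fintype.sum_prod_type, G, kroneckerMap_apply,
      conjTranspose_apply, A, of_apply, one_apply]
    have hgoal : ∀ z : ℂ, z = 2 * x * (v (i, 0) * star (v (n, 0)) + v (i, 1) * star (v (n, 1))) →
        z = if i = n then (x : ℂ) else 0 := by
      rintro z rfl
      rw [hin]
      split_ifs <;> ring
    apply hgoal
    fin_cases i <;> simp [hsc] at h0 h1 ⊢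
    · linear_combination s ^ 2 * (starRingEnd ℂ) (v (n, 0)) * h0 +
        s ^ 2 * (starRingEnd ℂ) (v (n, 1)) * h1 + x * (v (0, 0) * (starRingEnd ℂ) (v (n, 0)) +
          v (0, 1) * (starRingEnd ℂ) (v (n, 1))) * hss
    · linear_combination s ^ 2 * (starRingEnd ℂ) (v (n, 0)) * h0 +
        s ^ 2 * (starRingEnd ℂ) (v (n, 1)) * h1 + x * (v (1, 0) * (starRingEnd ℂ) (v (n, 0)) +
          v (1, 1) * (starRingEnd ℂ) (v (n, 1))) * hss
  have htr : ((G * ρ * Gᴴ) * swapMatrix).trace = ((2 * x : ℝ) : ℂ) := by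
    have h0 := hcontr 0 0
    have h1 := hcontr 1 1
    generalize G * ρ * Gᴴ = r at h0 h1
    simp only [Fin.sum_univ_two] at h0 h1
    simp [Matrix.trace, mul_apply, Fintype.sum_prod_type, swapMatrix]
    simp at h0 h1
    linear_combination h0 + h1
  rw [← hC, concurrence_eq_of_swap_conj hr (spinFlip_eq_swap_conj hr.isHermitian hcontr) htr
    (by linarith)]
  ring

/-! ### Fidelity, negativity and concurrence -/

theorem posSemidef_sub_smul_one {A : Matrix Idx Idx ℂ} (hA : A.IsHermitian) {c : ℝ}
    (hc : c ≤ minEigenvalue A) : (A - (c : ℂ) • 1).PosSemidef := by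
  have hH : (A - (c : ℂ) • 1).IsHermitian :=
    hA.sub (by rw [IsHermitian, conjTranspose_smul, conjTranspose_one]; simp)
  rw [hH.posSemidef_iff_eigenvalues_nonneg]
  intro i
  have he := hH.mulVec_eigenvectorBasis i
  have hne : (hH.eigenvectorBasis i).ofLp ≠ 0 := fun h =>
    hH.eigenvectorBasis.orthonormal.ne_zero i (by ext a; exact congrFun h a)
  rw [sub_mulVec, smul_mulVec, one_mulVec, sub_eq_iff_eq_add] at he
  have hle : minEigenvalue A ≤ hH.eigenvalues i + c := (isLeast_minEigenvalue hA).2 ⟨_, hne, by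
    rw [he]
    ext a
    simp [add_mul]⟩
  show 0 ≤ hH.eigenvalues i
  linarith

theorem overlap_sub_smul_one (A : Matrix Idx Idx ℂ) {v : Idx → ℂ} (hv : star v ⬝ᵥ v = 1) (c : ℝ) :
    star v ⬝ᵥ ((A - (c : ℂ) • 1) *ᵥ v) = star v ⬝ᵥ (A *ᵥ v) - c := by
  rw [sub_mulVec, smul_mulVec, one_mulVec, dotProduct_sub, dotProduct_smul, hv]
  simp

theorem le_overlap {A : Matrix Idx Idx ℂ} (hA : A.IsHermitian) {c : ℝ} (hc : c ≤ minEigenvalue A)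
    {v : Idx → ℂ} (hv : star v ⬝ᵥ v = 1) : c ≤ overlap A v := by
  have h := (posSemidef_sub_smul_one hA hc).re_dotProduct_nonneg v
  rw [overlap_sub_smul_one A hv] at h
  simp only [map_sub, RCLike.re_to_complex, Complex.ofReal_re] at h
  exact sub_nonneg.1 h

/-- A unit vector at which the form attains a lower bound of the spectrum is an eigenvector. -/
theorem mulVec_eq_of_overlap_eq {A : Matrix Idx Idx ℂ} (hA : A.IsHermitian) {c : ℝ}
    (hc : c ≤ minEigenvalue A) {v : Idx → ℂ} (hv : star v ⬝ᵥ v = 1) (h : overlap A v = c) :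
    A *ᵥ v = (c : ℂ) • v := by
  have hP := posSemidef_sub_smul_one hA hc
  have h0 : star v ⬝ᵥ ((A - (c : ℂ) • 1) *ᵥ v) = 0 := by
    have hnn := hP.dotProduct_mulVec_nonneg v
    apply Complex.ext
    · rw [overlap_sub_smul_one A hv, Complex.sub_re, Complex.ofReal_re, ← overlap, h]
      simp
    · exact (Complex.le_def.1 hnn).2.symm
  rw [hP.dotProduct_mulVec_zero_iff, sub_mulVec, smul_mulVec, one_mulVec, sub_eq_zero] at h0
  exact h0

theorem neg_half_negativity_le (ρ : Matrix Idx Idx ℂ) :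
    -negativity ρ / 2 ≤ minEigenvalue (partialTranspose ρ) := by
  have := le_max_right 0 (-2 * minEigenvalue (partialTranspose ρ))
  rw [negativity]
  linarith

/-- The fidelity is attained at the partner of a minimizer of the partially transposed form among
maximally entangled vectors. -/
theorem exists_fidelity_eq {ρ : Matrix Idx Idx ℂ} (hρ : IsState ρ) :
    ∃ v, IsMaxEntangled v ∧ fidelity ρ = 1 / 2 - overlap (partialTranspose ρ) v := by
  obtain ⟨ψ, hψ, h⟩ := (isGreatest_fidelity ρ).1
  refine ⟨flipSecond ψ, hψ.flipSecond, ?_⟩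
  rw [← hψ.flipSecond.overlap_flipSecond hρ.trace_eq_one, flipSecond_flipSecond, ← h]
  simp [overlap, mulVec_neg]

theorem half_sub_overlap_le_fidelity {ρ : Matrix Idx Idx ℂ} (hρ : IsState ρ) {v : Idx → ℂ}
    (hv : IsMaxEntangled v) : 1 / 2 - overlap (partialTranspose ρ) v ≤ fidelity ρ := by
  rw [← hv.overlap_flipSecond hρ.trace_eq_one]
  exact (isGreatest_fidelity ρ).2 ⟨_, hv.flipSecond, rfl⟩

theorem fidelity_le {ρ : Matrix Idx Idx ℂ} (hρ : IsState ρ) :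
    fidelity ρ ≤ (1 + negativity ρ) / 2 := by
  obtain ⟨v, hv, h⟩ := exists_fidelity_eq hρ
  have := le_overlap (partialTranspose_isHermitian hρ.posSemidef.isHermitian)
    (neg_half_negativity_le ρ) hv.star_dotProduct_self
  linarith

theorem negativity_eq_concurrence_of_fidelity_eq {ρ : Matrix Idx Idx ℂ} (hρ : IsState ρ)
    (h : fidelity ρ = (1 + negativity ρ) / 2) : negativity ρ = concurrence ρ := by
  obtain ⟨v, hv, hF⟩ := exists_fidelity_eq hρ
  have hN : 0 ≤ negativity ρ := le_max_left _ _
  have he := mulVec_eq_of_overlap_eq (partialTranspose_isHermitian hρ.posSemidef.isHermitian)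
    (neg_half_negativity_le ρ) hv.star_dotProduct_self (by linarith)
  rw [hv.concurrence_eq hρ.posSemidef (by linarith) he]
  ring

theorem exists_negative_eigenvector {ρ : Matrix Idx Idx ℂ} (hρ : ρ.IsHermitian)
    (hN : 0 < negativity ρ) : ∃ v : Idx → ℂ, star v ⬝ᵥ v = 1 ∧
      partialTranspose ρ *ᵥ v = ((-negativity ρ / 2 : ℝ) : ℂ) • v := by
  have hm : -negativity ρ / 2 = minEigenvalue (partialTranspose ρ) := by
    rw [negativity] at hN ⊢
    rw [max_eq_right (by by_contra h; rw [max_eq_left (le_of_not_ge h)] at hN; exact hN.ne rfl)]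
    ring
  obtain ⟨v, hv0, hv⟩ := (isLeast_minEigenvalue (partialTranspose_isHermitian hρ)).1
  obtain ⟨c, hc⟩ := exists_normalize hv0
  exact ⟨c • v, hc, by rw [mulVec_smul, hv, hm, smul_comm]⟩

/-- At the eigenvector of `ρ^Γ` for `-N / 2` the bound by the concurrence reads `N ≤ 2 C |det|`. -/
theorem negativity_le_concurrence_mul {ρ : Matrix Idx Idx ℂ} (hρ : ρ.PosSemidef)
    {v : Idx → ℂ} (hv : star v ⬝ᵥ v = 1)
    (h : partialTranspose ρ *ᵥ v = ((-negativity ρ / 2 : ℝ) : ℂ) • v) :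
    negativity ρ ≤ concurrence ρ * (2 * ‖qubitDet v‖) := by
  have hge := overlap_partialTranspose_ge hρ v
  rw [overlap_eq_of_mulVec_eq hv h] at hge
  linarith

theorem negativity_le_concurrence {ρ : Matrix Idx Idx ℂ} (hρ : ρ.PosSemidef) :
    negativity ρ ≤ concurrence ρ := by
  have hC : 0 ≤ concurrence ρ := le_max_left _ _
  rcases le_or_gt (negativity ρ) 0 with hN | hN
  · exact hN.trans hC
  · obtain ⟨v, hv, h⟩ := exists_negative_eigenvector hρ.isHermitian hN
    exact (negativity_le_concurrence_mul hρ hv h).trans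
      (mul_le_of_le_one_right hC (two_mul_norm_qubitDet_le hv))

theorem negativity_eq_concurrence_iff {ρ : Matrix Idx Idx ℂ} (hρ : ρ.PosSemidef)
    (hN : 0 < negativity ρ) {v : Idx → ℂ} (hv : star v ⬝ᵥ v = 1)
    (h : partialTranspose ρ *ᵥ v = ((-negativity ρ / 2 : ℝ) : ℂ) • v) :
    negativity ρ = concurrence ρ ↔ IsMaxEntangled v := by
  constructor
  · intro hNC
    refine isMaxEntangled_of_le_norm_qubitDet hv ?_
    have hle := negativity_le_concurrence_mul hρ hv h
    rw [← hNC] at hle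
    exact le_of_mul_le_mul_left (by linarith) hN
  · intro hmax
    rw [hmax.concurrence_eq hρ (by linarith) h]
    ring

end TwoQubit

end

theorem theorem1 (ρ : Matrix TwoQubit.Idx TwoQubit.Idx ℂ) (hρ : TwoQubit.IsState ρ) :
    TwoQubit.fidelity ρ ≤ (1 + TwoQubit.negativity ρ) / 2 ∧
    (1 + TwoQubit.negativity ρ) / 2 ≤ (1 + TwoQubit.concurrence ρ) / 2 ∧
    (TwoQubit.fidelity ρ = (1 + TwoQubit.negativity ρ) / 2 →
      TwoQubit.negativity ρ = TwoQubit.concurrence ρ) ∧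
    (0 < TwoQubit.negativity ρ →
      (TwoQubit.fidelity ρ = (1 + TwoQubit.negativity ρ) / 2 ↔
        TwoQubit.negativity ρ = TwoQubit.concurrence ρ) ∧
      ∃ (x : ℝ) (v : TwoQubit.Idx → ℂ),
        x < 0 ∧ star v ⬝ᵥ v = 1 ∧ TwoQubit.partialTranspose ρ *ᵥ v = (x : ℂ) • v ∧
        (∀ (y : ℝ) (w : TwoQubit.Idx → ℂ), y < 0 → w ≠ 0 →
          TwoQubit.partialTranspose ρ *ᵥ w = (y : ℂ) • w → y = x ∧ ∃ c : ℂ, w = c • v) ∧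
        (TwoQubit.negativity ρ = TwoQubit.concurrence ρ ↔ TwoQubit.IsMaxEntangled v)) := by
  have hP := hρ.posSemidef
  refine ⟨TwoQubit.fidelity_le hρ, by linarith [TwoQubit.negativity_le_concurrence hP],
    TwoQubit.negativity_eq_concurrence_of_fidelity_eq hρ, fun hN => ?_⟩
  obtain ⟨v, hv, he⟩ := TwoQubit.exists_negative_eigenvector hP.isHermitian hN
  have hiff := TwoQubit.negativity_eq_concurrence_iff hP hN hv he
  have hx : -TwoQubit.negativity ρ / 2 < 0 := by linarith
  refine ⟨⟨TwoQubit.negativity_eq_concurrence_of_fidelity_eq hρ, fun hNC => ?_⟩,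
    _, v, hx, hv, he, fun y w hy hw0 hw =>
      TwoQubit.negative_eigenvector_unique hP hx hy hv hw0 he hw, hiff⟩
  have hF := TwoQubit.half_sub_overlap_le_fidelity hρ (hiff.1 hNC)
  rw [TwoQubit.overlap_eq_of_mulVec_eq hv he] at hF
  exact le_antisymm (TwoQubit.fidelity_le hρ) (by linarith)
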